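/- Let $K$ be an algebraically closed field of characteristic zero and let $Z\subset K^3$ be an irreducible affine surface with (irreducible) defining polynomial $f\in K[x,y,z]$, given by a (not necessarily proper) rational parametrization $Q(t,s)=(Q_1,Q_2,Q_3)\in K(t,s)^3$, i.e. $Z$ is the Zariski closure of the image of $Q$. Assume that $Z$ is not a plane. Let $A=(a,b,c)\in K^3$. Put $$\chi_1(t,s)=\frac{Q_2(t,s)-b}{Q_1(t,s)-a},\qquad \chi_2(t,s)=\frac{Q_3(t,s)-c}{Q_1(t,s)-a},$$ and let $g_i(t,s,h_1,h_2)$ be the numerator, in reduced form, of $\chi_i(t,s)-\chi_i(h_1,h_2)$ for $i=1,2$, where $h_1,h_2$ are new variables. Let $G=\gcd(g_1,g_2)$, computed in $K[h_1,h_2][t,s]$, and set $g^{Q,A}=G$ if $G$ has positive total degree in $\{t,s\}$ and $g^{Q,A}=1$ otherwise. Then the following are equivalent: 1. $Z$ is a cone with vertex $A$, i.e. for every $p\in Z$ and every $r\in K$ the point $A+r(p-A)$ lies in $Z$; 2. $g^{Q,A}\neq 1$; 3. the multiplicity of $A$ on $Z$, i.e. the lowest degree of a nonzero homogeneous component of $f(x+a,y+b,z+c)$,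 equals $\deg Z=\deg f$. -/

import Mathlib

namespace RationalSurface

variable (K : Type*) [Field K]

/-- The polynomial ring `K[t, s]` (`t = X 0`, `s = X 1`). -/
abbrev ParamRing : Type _ := MvPolynomial (Fin 2) K

/-- The field of rational functions `K(t, s)`. -/
abbrev ParamField : Type _ := FractionRing (ParamRing K)

/-- The polynomial ring `K[h₁, h₂][t, s]`: the outer variables are `t, s`, the coefficients are
polynomials in `h₁, h₂`. -/
abbrev DoubleRing : Type _ := MvPolynomial (Fin 2) (ParamRing K)

/-- The field of rational functions `K(h₁, h₂, t, s)`. -/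
abbrev DoubleField : Type _ := FractionRing (DoubleRing K)

variable {K}

/-! ### Affine surfaces in three-space -/

/-- `f` is the defining polynomial of the irreducible affine surface `Z ⊆ K³`. -/
def IsDefiningPolynomial (f : MvPolynomial (Fin 3) K) (Z : Set (Fin 3 → K)) : Prop :=
  Irreducible f ∧ Z = {p | MvPolynomial.eval p f = 0}

/-- `Z` is a plane `n₀ x + n₁ y + n₂ z = d` with `n ≠ 0`. -/
def IsPlane (Z : Set (Fin 3 → K)) : Prop :=
  ∃ (n : Fin 3 → K) (d : K), n ≠ 0 ∧ Z = {p | ∑ i, n i * p i = d}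

/-- `Z` is a cone with vertex `A`: it contains the line through `A` and `p` for each of its points
`p`. -/
def IsConeWithVertex (Z : Set (Fin 3 → K)) (A : Fin 3 → K) : Prop :=
  ∀ p ∈ Z, ∀ r : K, AffineMap.lineMap A p r ∈ Z

/-- The translated polynomial `f(x + a, y + b, z + c)`, where `A = (a, b, c)`. -/
noncomputable def translate (f : MvPolynomial (Fin 3) K) (A : Fin 3 → K) :
    MvPolynomial (Fin 3) K :=
  MvPolynomial.aeval (fun i => MvPolynomial.X i + MvPolynomial.C (A i)) f

/-- The multiplicity of the point `A` on the surface `f = 0` (for `f ≠ 0`): the degree of the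
lowest nonzero homogeneous component of the expansion of `f` at `A`. -/
noncomputable def multiplicityAt (f : MvPolynomial (Fin 3) K) (A : Fin 3 → K) : ℕ :=
  sInf {n | MvPolynomial.homogeneousComponent n (translate f A) ≠ 0}

/-! ### Rational parametrizations -/

/-- The set of points `Q(t₀, s₀)`, where `(t₀, s₀)` runs over the points of `K²` at which none of
the denominators of `Q` (in reduced form) vanishes. -/
def paramImage (Q : Fin 3 → ParamField K) : Set (Fin 3 → K) :=
  {p | ∃ u : Fin 2 → K, ∀ i,
    MvPolynomial.eval u (IsFractionRing.den (ParamRing K) (Q i) : ParamRing K) ≠ 0 ∧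
    p i = MvPolynomial.eval u (IsFractionRing.num (ParamRing K) (Q i)) /
      MvPolynomial.eval u (IsFractionRing.den (ParamRing K) (Q i) : ParamRing K)}

/-- `Q` is a (not necessarily proper) rational parametrization of `Z`: the Zariski closure of its
image is `Z`. -/
def IsRationalParametrization (Q : Fin 3 → ParamField K) (Z : Set (Fin 3 → K)) : Prop :=
  MvPolynomial.zeroLocus K (MvPolynomial.vanishingIdeal K (paramImage Q)) = Z

/-- A rational function `χ(t, s)` regarded as an element of `K(h₁, h₂, t, s)`. -/
noncomputable def inTS : ParamField K →+* DoubleField K :=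
  IsFractionRing.map (j := (MvPolynomial.map MvPolynomial.C : ParamRing K →+* DoubleRing K))
    (MvPolynomial.map_injective _ (MvPolynomial.C_injective _ _))

/-- The rational function `χ(h₁, h₂)` obtained from `χ(t, s)` by renaming `t, s` to `h₁, h₂`,
as an element of `K(h₁, h₂, t, s)`. -/
noncomputable def inH : ParamField K →+* DoubleField K :=
  IsFractionRing.map (j := (MvPolynomial.C : ParamRing K →+* DoubleRing K))
    (MvPolynomial.C_injective _ _)

/-- A constant of `K` as a rational function in `t, s`. -/
noncomputable def const (a : K) : ParamField K :=
  algebraMap (ParamRing K) (ParamField K) (MvPolynomial.C a)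

/-- The components of `Φ_{2,3}(A)`: `χ₁ = (Q₂ - b) / (Q₁ - a)` and `χ₂ = (Q₃ - c) / (Q₁ - a)`
for `A = (a, b, c)` and `Q = (Q₁, Q₂, Q₃)`. -/
noncomputable def chi (Q : Fin 3 → ParamField K) (A : Fin 3 → K) (i : Fin 2) : ParamField K :=
  (Q i.succ - const (A i.succ)) / (Q 0 - const (A 0))

/-- The polynomials `g_i = numer(χ_i(t, s) - χ_i(h₁, h₂))`, numerator in reduced form. -/
noncomputable def gPolyComponent (Q : Fin 3 → ParamField K) (A : Fin 3 → K) (i : Fin 2) :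
    DoubleRing K :=
  IsFractionRing.num (DoubleRing K) (inTS (chi Q A i) - inH (chi Q A i))

/-- `gcd(g₁, g₂)` in `K[h₁, h₂][t, s]` (determined up to a nonzero constant factor). -/
noncomputable def gGcd (Q : Fin 3 → ParamField K) (A : Fin 3 → K) : DoubleRing K :=
  (UniqueFactorizationMonoid.toGCDMonoid (DoubleRing K)).gcd
    (gPolyComponent Q A 0) (gPolyComponent Q A 1)

/-- The polynomial `g^{Q,A}`: the gcd if it has positive total degree in `t, s`, and `1`
otherwise. -/
noncomputable def gPoly (Q : Fin 3 → ParamField K) (A : Fin 3 → K) : DoubleRing K :=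
  if 0 < (gGcd Q A).totalDegree then gGcd Q A else 1

end RationalSurface

/-! Write F for the translate of `f` that moves A to the origin. Every condition is equivalent to
algebraic dependence of χ₁, χ₂ over K.

The multiplicity of A is deg f exactly when F has a single homogeneous component. The cone condition
says that F(p) = 0 implies F(rp) = 0 for all r; then every component of F vanishes where F does, so
F divides it (Nullstellensatz), and by degree only the top one survives. So both conditions say that
F is homogeneous.

The relations satisfied by Q - A form the ideal (F). If F is homogeneous, F(Q - A) = (Q₁ - a)^d F(1,
χ₁, χ₂) gives a relation between the χᵢ. Conversely such a relation, homogenized, is a multiple of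
F, and a divisor of a nonzero homogeneous polynomial is homogeneous (`isHomogeneous_translate_iff`).

The gcd detects common components of the loci χᵢ(t,s) = χᵢ(h₁,h₂). Given a relation nonsingular in
χᵢ, take a component, containing the diagonal, of the locus of the other χⱼ: Taylor expansion near
the diagonal shows that χᵢ(t,s) = χᵢ(h₁,h₂) holds there too (`exists_common_factor`). If instead the
χᵢ are independent, K(t,s) is algebraic over K(χ₁,χ₂), so on a common component both t and s are
algebraic over K(h₁,h₂); a single equation of positive degree in t, s cannot force this
(`not_algebraicIndependent_of_common_factor`). -/

namespace RationalSurface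

open MvPolynomial

/-! ### The ideal of relations between the components of a parametrization -/

section Parametrization

variable {K : Type*} [Field K]

/-- Denominators can be cleared in `P(Q)` uniformly, for all specializations of `t, s`. -/
theorem exists_clear_denominators {ι σ : Type*} (nm dn : ι → MvPolynomial σ K)
    (P : MvPolynomial ι K) :
    ∃ D N : MvPolynomial σ K, (∃ k : ι →₀ ℕ, D = k.prod fun i e => dn i ^ e) ∧
      ∀ (S : Type _) [CommRing S] [Algebra K S] (φ : MvPolynomial σ K →ₐ[K] S) (q : ι → S),
        (∀ i, φ (dn i) * q i = φ (nm i)) → φ D * aeval q P = φ N := by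
  classical
  induction P using MvPolynomial.induction_on with
  | C a =>
    refine ⟨1, C a, ⟨0, by simp⟩, fun S _ _ φ q _ => ?_⟩
    simp [MvPolynomial.algHom_C]
  | add P P' h h' =>
    obtain ⟨D, N, ⟨k, rfl⟩, h⟩ := h
    obtain ⟨D', N', ⟨k', rfl⟩, h'⟩ := h'
    refine ⟨_, (k'.prod fun i e => dn i ^ e) * N + (k.prod fun i e => dn i ^ e) * N',
      ⟨k + k', rfl⟩, fun S _ _ φ q hq => ?_⟩
    rw [Finsupp.prod_add_index' (by simp) (fun _ _ _ => pow_add _ _ _), map_add, map_add, map_mul,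
      map_mul, map_mul, ← h S φ q hq, ← h' S φ q hq]
    ring
  | mul_X P i h =>
    obtain ⟨D, N, ⟨k, rfl⟩, h⟩ := h
    refine ⟨_, N * nm i, ⟨k + Finsupp.single i 1, rfl⟩, fun S _ _ φ q hq => ?_⟩
    rw [Finsupp.prod_add_index' (by simp) (fun _ _ _ => pow_add _ _ _),
      Finsupp.prod_single_index (by simp), map_mul, map_mul, map_mul, ← h S φ q hq, ← hq i, aeval_X,
      pow_one]
    ring

theorem const_eq_algebraMap (a : K) : const a = algebraMap K (ParamField K) a := by
  rw [const, ← MvPolynomial.algebraMap_eq, ← IsScalarTower.algebraMap_apply]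

/-- One cleared numerator N serves both the generic point and all specializations, and over an
infinite field N is zero once it vanishes off the zero set of the denominators. -/
theorem mem_vanishingIdeal_paramImage_iff [Infinite K] (Q : Fin 3 → ParamField K)
    (P : MvPolynomial (Fin 3) K) :
    P ∈ vanishingIdeal K (paramImage Q) ↔ aeval Q P = 0 := by
  obtain ⟨D, N, ⟨k, rfl⟩, h⟩ := exists_clear_denominators
    (fun i => IsFractionRing.num (ParamRing K) (Q i))
    (fun i => (IsFractionRing.den (ParamRing K) (Q i) : ParamRing K)) P
  set D := k.prod fun i e => (IsFractionRing.den (ParamRing K) (Q i) : ParamRing K) ^ e with hD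
  have hD0 : D ≠ 0 := by
    refine Finset.prod_ne_zero_iff.2 fun i _ => pow_ne_zero _ ?_
    exact nonZeroDivisors.ne_zero (IsFractionRing.den (ParamRing K) (Q i)).2
  have hF := h (ParamField K) (IsScalarTower.toAlgHom K (ParamRing K) (ParamField K)) Q (by
    intro i
    simp only [IsScalarTower.toAlgHom_apply]
    exact (mul_comm _ _).trans (IsFractionRing.num_mul_den_eq_num_iff_eq.2 rfl))
  simp only [IsScalarTower.toAlgHom_apply] at hF
  have hinj := IsFractionRing.injective (ParamRing K) (ParamField K)
  have hD0' : algebraMap (ParamRing K) (ParamField K) D ≠ 0 := by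
    rwa [Ne, map_eq_zero_iff _ hinj]
  have hN : aeval Q P = 0 ↔ N = 0 := by
    rw [← map_eq_zero_iff _ hinj, ← hF, mul_eq_zero, or_iff_right hD0']
  rw [hN, mem_vanishingIdeal_iff]
  constructor
  · intro hP
    -- Points of `paramImage` need all denominators nonzero, while `D` may omit some; multiplying by
    -- `E` makes the product vanish on all of K².
    let E : ParamRing K := ∏ i, (IsFractionRing.den (ParamRing K) (Q i) : ParamRing K)
    have hE : E ≠ 0 := Finset.prod_ne_zero_iff.2 fun i _ =>
      nonZeroDivisors.ne_zero (IsFractionRing.den (ParamRing K) (Q i)).2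
    suffices N * E = 0 from (mul_eq_zero.1 this).resolve_right hE
    refine MvPolynomial.funext fun u => ?_
    rw [map_mul, map_zero, mul_eq_zero, or_iff_not_imp_right]
    intro hu
    rw [map_prod, ← Ne, Finset.prod_ne_zero_iff] at hu
    have := h K (aeval u) (fun i => eval u (IsFractionRing.num (ParamRing K) (Q i)) /
      eval u (IsFractionRing.den (ParamRing K) (Q i) : ParamRing K)) (fun i => by
        have := hu i (Finset.mem_univ i)
        simp only [aeval_eq_eval]
        exact mul_div_cancel₀ _ this)
    rw [hP _ ⟨u, fun i => ⟨hu i (Finset.mem_univ i), rfl⟩⟩, mul_zero] at this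
    simpa [aeval_eq_eval] using this.symm
  · rintro rfl p ⟨u, hu⟩
    have := h K (aeval u) p (fun i => by
      rw [(hu i).2]
      simp only [aeval_eq_eval]
      exact mul_div_cancel₀ _ (hu i).1)
    rw [map_zero, mul_eq_zero] at this
    refine this.resolve_left ?_
    rw [hD, Finsupp.prod, map_prod]
    refine Finset.prod_ne_zero_iff.2 fun i _ => ?_
    rw [map_pow]
    exact pow_ne_zero _ (by simpa [aeval_eq_eval] using (hu i).1)

/-- A polynomial vanishing on an irreducible hypersurface is divisible by its equation. -/
theorem dvd_of_forall_eval_eq_zero [IsAlgClosed K] {n : ℕ} {f P : MvPolynomial (Fin n) K}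
    (hf : Irreducible f) (h : ∀ p, eval p f = 0 → eval p P = 0) : f ∣ P := by
  have hprime : (Ideal.span {f}).IsPrime :=
    (Ideal.span_singleton_prime hf.ne_zero).2 (UniqueFactorizationMonoid.irreducible_iff_prime.1 hf)
  rw [← Ideal.mem_span_singleton,
    ← MvPolynomial.IsPrime.vanishingIdeal_zeroLocus (K := K) (Ideal.span {f})]
  rw [mem_vanishingIdeal_iff]
  intro p hp
  rw [zeroLocus_span] at hp
  exact h p (hp f rfl)

variable [IsAlgClosed K] {Z : Set (Fin 3 → K)} {f : MvPolynomial (Fin 3) K}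
  {Q : Fin 3 → ParamField K}

theorem aeval_param_eq_zero_iff (hf : IsDefiningPolynomial f Z)
    (hQ : IsRationalParametrization Q Z) (P : MvPolynomial (Fin 3) K) :
    aeval Q P = 0 ↔ f ∣ P := by
  have : Infinite K := IsAlgClosed.instInfinite
  rw [← mem_vanishingIdeal_paramImage_iff]
  constructor
  · intro hP
    refine dvd_of_forall_eval_eq_zero hf.1 fun p hp => ?_
    have hpZ : p ∈ Z := by rw [hf.2]; exact hp
    rw [← hQ] at hpZ
    exact hpZ P hP
  · rintro ⟨g, rfl⟩
    rw [mem_vanishingIdeal_iff]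
    intro p hp
    have hpZ : p ∈ Z := by
      rw [← hQ]
      exact zeroLocus_vanishingIdeal_le _ hp
    rw [hf.2] at hpZ
    have : eval p f = 0 := hpZ
    simp [aeval_eq_eval, this]

/-- The irreducible `f` divides a nonzero polynomial of degree at most 1, so the cofactor is a
nonzero constant. -/
theorem isPlane_of_linear_relation (hf : IsDefiningPolynomial f Z)
    (hQ : IsRationalParametrization Q Z) (n : Fin 3 → K) (hn : n ≠ 0) (d : K)
    (h : ∑ i, algebraMap K (ParamField K) (n i) * Q i = algebraMap K (ParamField K) d) :
    IsPlane Z := by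
  obtain ⟨g, hg⟩ := (aeval_param_eq_zero_iff hf hQ (∑ i, C (n i) * X i - C d)).1 (by
    simp [h])
  have hl0 : (∑ i, C (n i) * X i - C d : MvPolynomial (Fin 3) K) ≠ 0 := by
    intro h0
    refine hn (funext fun j => ?_)
    have h1 := congrArg (eval (Pi.single j 1)) h0
    have h2 := congrArg (eval 0) h0
    simp at h1 h2
    simpa [h2, Pi.single_apply] using h1
  have hdeg : (∑ i, C (n i) * X i - C d : MvPolynomial (Fin 3) K).totalDegree ≤ 1 := by
    refine (totalDegree_sub_C_le _ _).trans ?_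
    refine totalDegree_finsetSum_le fun i _ => ?_
    refine (totalDegree_mul _ _).trans ?_
    simp
  have hg0 : g ≠ 0 := by rintro rfl; exact hl0 (by simpa using hg)
  rw [hg, totalDegree_mul_of_isDomain hf.1.ne_zero hg0] at hdeg
  have hfd : f.totalDegree ≠ 0 := by
    intro h0
    rw [totalDegree_eq_zero_iff_eq_C] at h0
    refine hf.1.not_isUnit ?_
    rw [h0]
    refine IsUnit.map C (IsUnit.mk0 _ fun h1 => hf.1.ne_zero ?_)
    rw [h0, h1, map_zero]
  have hgd : g.totalDegree = 0 := by omega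
  rw [totalDegree_eq_zero_iff_eq_C] at hgd
  have hc : coeff 0 g ≠ 0 := fun h0 => hg0 (by rw [hgd, h0, map_zero])
  refine ⟨n, d, hn, ?_⟩
  rw [hf.2]
  ext p
  have h3 := congrArg (eval p) hg
  rw [hgd] at h3
  simp only [map_sub, map_sum, map_mul, eval_C, eval_X] at h3
  simp only [Set.mem_ofPred_eq]
  rw [← sub_eq_zero (b := d), h3, mul_eq_zero, or_iff_left hc]

theorem param_ne_const (hf : IsDefiningPolynomial f Z)
    (hQ : IsRationalParametrization Q Z) (hplane : ¬ IsPlane Z) (i : Fin 3) (a : K) :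
    Q i - const a ≠ 0 := by
  intro h
  refine hplane (isPlane_of_linear_relation hf hQ (Pi.single i 1)
    (fun h0 => one_ne_zero (α := K) (by simpa using congrFun h0 i)) a ?_)
  rw [← const_eq_algebraMap a, ← sub_eq_zero.1 h, Finset.sum_eq_single i] <;>
    simp +contextual

theorem chi_ne_const (hf : IsDefiningPolynomial f Z)
    (hQ : IsRationalParametrization Q Z) (hplane : ¬ IsPlane Z) (A : Fin 3 → K) (i : Fin 2)
    (e : K) : chi Q A i ≠ algebraMap K (ParamField K) e := by
  intro h
  have h0 := param_ne_const hf hQ hplane 0 (A 0)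
  rw [chi, div_eq_iff h0, const_eq_algebraMap, const_eq_algebraMap] at h
  refine hplane (isPlane_of_linear_relation hf hQ (Pi.single i.succ 1 - Pi.single 0 e)
    (fun h0 => one_ne_zero (α := K) (by simpa [Pi.single_apply] using congrFun h0 i.succ))
    (A i.succ - e * A 0) ?_)
  have : Q i.succ = algebraMap K (ParamField K) (A i.succ) + algebraMap K (ParamField K) e *
      (Q 0 - algebraMap K (ParamField K) (A 0)) := by rw [← h]; ring
  simp only [Pi.sub_apply, map_sub, sub_mul, Finset.sum_sub_distrib]
  rw [Finset.sum_eq_single i.succ (by simp +contextual) (by simp),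
    Finset.sum_eq_single 0 (by simp +contextual) (by simp), this]
  simp
  ring

end Parametrization

/-! ### Cones, homogeneity of the translate, and dependence of χ₁, χ₂ -/

section Cone

variable {K : Type*} [Field K]

/-- Translation by `A` as an automorphism of the polynomial ring. -/
noncomputable def translateEquiv (A : Fin 3 → K) :
    MvPolynomial (Fin 3) K ≃ₐ[K] MvPolynomial (Fin 3) K :=
  AlgEquiv.ofAlgHom (aeval fun i => X i + C (A i)) (aeval fun i => X i + C (-A i))
    (by ext i; simp [MvPolynomial.algHom_C]) (by ext i; simp [MvPolynomial.algHom_C])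

theorem translateEquiv_apply (A : Fin 3 → K) (f : MvPolynomial (Fin 3) K) :
    translateEquiv A f = translate f A := rfl

theorem aeval_translate {S : Type*} [CommRing S] [Algebra K S] (f : MvPolynomial (Fin 3) K)
    (A : Fin 3 → K) (q : Fin 3 → S) :
    aeval q (translate f A) = aeval (fun i => q i + algebraMap K S (A i)) f := by
  have : (aeval q).comp (aeval fun i => X i + C (A i)) =
      aeval (R := K) (fun i => q i + algebraMap K S (A i)) := by
    ext i; simp [MvPolynomial.algHom_C]
  exact congrArg (fun φ => φ f) this

theorem totalDegree_translate_le (f : MvPolynomial (Fin 3) K) (A : Fin 3 → K) :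
    (translate f A).totalDegree ≤ f.totalDegree := by
  rw [translate, aeval_def, eval₂_eq]
  refine totalDegree_finsetSum_le fun d hd => ?_
  refine (totalDegree_mul _ _).trans ?_
  rw [algebraMap_eq, totalDegree_C, zero_add]
  refine (totalDegree_finsetProd _ _).trans ?_
  refine le_trans ?_ (le_totalDegree hd)
  refine Finset.sum_le_sum fun i _ => ?_
  refine (totalDegree_pow _ _).trans ?_
  refine (Nat.mul_le_mul_left _ ?_).trans (mul_one _).le
  refine (totalDegree_add _ _).trans ?_
  simp

theorem totalDegree_translate (f : MvPolynomial (Fin 3) K) (A : Fin 3 → K) :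
    (translate f A).totalDegree = f.totalDegree := by
  refine (totalDegree_translate_le f A).antisymm ?_
  conv_lhs => rw [← (translateEquiv A).symm_apply_apply f]
  exact totalDegree_translate_le _ _

theorem isHomogeneous_of_forall_homogeneousComponent {σ : Type*} {F : MvPolynomial σ K} {d : ℕ}
    (h : ∀ n, n ≠ d → homogeneousComponent n F = 0) : F.IsHomogeneous d := by
  rw [← sum_homogeneousComponent F]
  refine IsHomogeneous.sum _ _ _ fun n _ => ?_
  by_cases hn : n = d
  · subst hn
    exact homogeneousComponent_isHomogeneous _ _
  · rw [h n hn]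
    exact isHomogeneous_zero _ _ _

/-- Translation preserves total degree, so there are no components above deg f; multiplicity deg f
excludes those below. -/
theorem multiplicityAt_eq_iff {f : MvPolynomial (Fin 3) K} (hf : f ≠ 0) (A : Fin 3 → K) :
    multiplicityAt f A = f.totalDegree ↔ (translate f A).IsHomogeneous f.totalDegree := by
  have h0 : translate f A ≠ 0 := by
    rwa [← translateEquiv_apply, Ne, map_eq_zero_iff _ (translateEquiv A).injective]
  constructor
  · intro h
    refine isHomogeneous_of_forall_homogeneousComponent fun n hn => ?_
    rcases lt_or_gt_of_ne hn with hlt | hgt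
    · rw [← h] at hlt
      simpa using Nat.notMem_of_lt_sInf hlt
    · rw [← totalDegree_translate f A] at hgt
      exact homogeneousComponent_eq_zero _ _ hgt
  · intro h
    have : {n | homogeneousComponent n (translate f A) ≠ 0} = {f.totalDegree} := by
      ext n
      rw [Set.mem_ofPred_eq, homogeneousComponent_of_mem h, Set.mem_singleton_iff]
      split_ifs with hn <;> simp [hn, h0]
    rw [multiplicityAt, this, csInf_singleton]

/-- The substitution `F(x) ↦ F(T x)`, with a new variable `T` that records the degree. -/
noncomputable def scaleHom (σ K : Type*) [CommRing K] :
    MvPolynomial σ K →ₐ[K] Polynomial (MvPolynomial σ K) :=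
  aeval fun i => Polynomial.C (X i) * Polynomial.X

theorem scaleHom_of_isHomogeneous {σ : Type*} {F : MvPolynomial σ K} {d : ℕ}
    (hF : F.IsHomogeneous d) : scaleHom σ K F = Polynomial.C F * Polynomial.X ^ d := by
  rw [scaleHom, aeval_def, eval₂_eq]
  conv_rhs => rw [F.as_sum, map_sum, Finset.sum_mul]
  refine Finset.sum_congr rfl fun m hm => ?_
  have hd : ∑ i ∈ m.support, m i = d := by
    have := hF.degree_eq_sum_deg_support hm
    exact this.symm
  rw [← hd, ← Finset.prod_pow_eq_pow_sum, monomial_eq, map_mul, Finsupp.prod, map_prod, mul_assoc,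
    ← Finset.prod_mul_distrib]
  congr 1
  exact Finset.prod_congr rfl fun i _ => by rw [map_pow, mul_pow]

theorem coeff_scaleHom {σ : Type*} (F : MvPolynomial σ K) (n : ℕ) :
    (scaleHom σ K F).coeff n = homogeneousComponent n F := by
  conv_lhs => rw [← sum_homogeneousComponent F, map_sum, Polynomial.finsetSum_coeff]
  rw [Finset.sum_congr rfl fun i _ => by
    rw [scaleHom_of_isHomogeneous (homogeneousComponent_isHomogeneous i F),
      Polynomial.coeff_C_mul_X_pow]]
  rw [Finset.sum_ite_eq, ite_eq_left_iff, Finset.mem_range, not_lt]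
  intro hn
  exact (homogeneousComponent_eq_zero _ _ hn).symm

/-- Degree and trailing degree in T are additive under `scaleHom`. They agree for the product, a
monomial in T, hence for each factor. -/
theorem isHomogeneous_of_dvd {σ : Type*} {F H : MvPolynomial σ K} {d : ℕ}
    (hH : H.IsHomogeneous d) (hH0 : H ≠ 0) (hFH : F ∣ H) : ∃ k, F.IsHomogeneous k := by
  obtain ⟨G, rfl⟩ := hFH
  have hmul := scaleHom_of_isHomogeneous hH
  rw [map_mul] at hmul
  have hne : scaleHom σ K F * scaleHom σ K G ≠ 0 := by
    rw [hmul]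
    exact mul_ne_zero (Polynomial.C_ne_zero.2 hH0) (pow_ne_zero _ Polynomial.X_ne_zero)
  obtain ⟨hF0, hG0⟩ := mul_ne_zero_iff.1 hne
  have h1 := congrArg Polynomial.natDegree hmul
  have h2 := congrArg Polynomial.natTrailingDegree hmul
  rw [Polynomial.natDegree_mul hF0 hG0, Polynomial.natDegree_C_mul_X_pow _ _ hH0] at h1
  rw [Polynomial.natTrailingDegree_mul hF0 hG0, Polynomial.C_mul_X_pow_eq_monomial,
    Polynomial.natTrailingDegree_monomial hH0] at h2
  have h3 := Polynomial.natTrailingDegree_le_natDegree (scaleHom σ K F)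
  have h4 := Polynomial.natTrailingDegree_le_natDegree (scaleHom σ K G)
  refine ⟨(scaleHom σ K F).natDegree, isHomogeneous_of_forall_homogeneousComponent fun n hn => ?_⟩
  rw [← coeff_scaleHom]
  rcases lt_or_gt_of_ne hn with hlt | hgt
  · exact Polynomial.coeff_eq_zero_of_lt_natTrailingDegree (by omega)
  · exact Polynomial.coeff_eq_zero_of_natDegree_lt hgt

theorem eval₂_scaleHom {σ : Type*} (F : MvPolynomial σ K) {S : Type*} [CommRing S] [Algebra K S]
    (r : S) (q : σ → S) :
    (scaleHom σ K F).eval₂ (aeval q : MvPolynomial σ K →ₐ[K] S) r =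
      aeval (fun i => r * q i) F := by
  induction F using MvPolynomial.induction_on with
  | C a => simp [MvPolynomial.algHom_C, Polynomial.algebraMap_apply]
  | add P P' h h' => rw [map_add, Polynomial.eval₂_add, h, h', map_add]
  | mul_X P i h =>
    have hX : scaleHom σ K (X i) = Polynomial.C (X i) * Polynomial.X := aeval_X _ _
    rw [map_mul, Polynomial.eval₂_mul, h, map_mul, hX, Polynomial.eval₂_mul, Polynomial.eval₂_C,
      Polynomial.eval₂_X, RingHom.coe_coe, aeval_X, aeval_X, mul_comm r]

theorem aeval_smul_of_isHomogeneous {σ : Type*} {F : MvPolynomial σ K} {d : ℕ}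
    (hF : F.IsHomogeneous d) {S : Type*} [CommRing S] [Algebra K S] (r : S) (q : σ → S) :
    aeval (fun i => r * q i) F = r ^ d * aeval q F := by
  rw [← eval₂_scaleHom, scaleHom_of_isHomogeneous hF]
  rw [Polynomial.eval₂_mul, Polynomial.eval₂_C, Polynomial.eval₂_pow, Polynomial.eval₂_X,
    RingHom.coe_coe, mul_comm]

theorem isConeWithVertex_iff [IsAlgClosed K] {Z : Set (Fin 3 → K)} {f : MvPolynomial (Fin 3) K}
    (hf : IsDefiningPolynomial f Z) (A : Fin 3 → K) :
    IsConeWithVertex Z A ↔ (translate f A).IsHomogeneous f.totalDegree := by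
  have : Infinite K := IsAlgClosed.instInfinite
  have hirr : Irreducible (translate f A) := by
    rw [← translateEquiv_apply]
    exact (MulEquiv.irreducible_iff (translateEquiv A)).2 hf.1
  have hZ : ∀ p, p + A ∈ Z ↔ eval p (translate f A) = 0 := fun p => by
    rw [hf.2, Set.mem_ofPred_eq, ← aeval_eq_eval, ← aeval_eq_eval, aeval_translate]
    rfl
  have hline : ∀ (p : Fin 3 → K) (r : K), AffineMap.lineMap A (p + A) r = (fun i => r * p i) + A :=
    fun p r => by
      ext i; simp [AffineMap.lineMap_apply]
  have key : IsConeWithVertex Z A ↔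
      ∀ p, eval p (translate f A) = 0 → ∀ r : K, eval (fun i => r * p i) (translate f A) = 0 := by
    constructor
    · intro h p hp r
      rw [← hZ, ← hline]
      exact h _ ((hZ p).2 hp) r
    · intro h p hp r
      have := (hZ _).2 (h (p - A) ((hZ _).1 (by simpa using hp)) r)
      rwa [← hline, sub_add_cancel] at this
  rw [key, ← totalDegree_translate f A]
  generalize translate f A = F at hirr ⊢
  constructor
  · intro h
    refine isHomogeneous_of_forall_homogeneousComponent fun n hn => ?_
    rcases lt_or_gt_of_ne hn with hlt | hgt
    · by_contra h0
      have hdvd : F ∣ homogeneousComponent n F := by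
        refine dvd_of_forall_eval_eq_zero hirr fun p hp => ?_
        -- The coefficients of r ↦ F(rp) are the components of F at p, and K is infinite.
        have hz : (scaleHom (Fin 3) K F).map (eval p) = 0 := by
          refine Polynomial.funext fun r => ?_
          have h1 := eval₂_scaleHom F r p
          rw [aeval_eq_eval, h p hp r] at h1
          rw [Polynomial.eval_map, Polynomial.eval_zero]
          exact h1
        have := congrArg (fun P => P.coeff n) hz
        simpa [Polynomial.coeff_map, coeff_scaleHom] using this
      have := totalDegree_le_of_dvd_of_isDomain hdvd h0
      have := (homogeneousComponent_isHomogeneous n F).totalDegree_le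
      omega
    · exact homogeneousComponent_eq_zero _ _ hgt
  · intro h p hp r
    have := aeval_smul_of_isHomogeneous h r p
    simp only [aeval_eq_eval] at this
    rw [this, hp, mul_zero]

/-- Homogenization of a polynomial in two variables, with respect to the new variable `X 0`. -/
theorem exists_homogenization (P : MvPolynomial (Fin 2) K) :
    ∃ (d : ℕ) (H : MvPolynomial (Fin 3) K), H.IsHomogeneous d ∧
      aeval (Fin.cons 1 X : Fin 3 → MvPolynomial (Fin 2) K) H = P := by
  refine ⟨P.totalDegree, ∑ m ∈ P.support, C (coeff m P) *
    (X 0 ^ (P.totalDegree - m.degree) * ∏ i : Fin 2, X i.succ ^ m i), ?_, ?_⟩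
  · refine IsHomogeneous.sum _ _ _ fun m hm => ?_
    have hle : m.degree ≤ P.totalDegree := le_totalDegree hm
    have h1 : (∏ i : Fin 2, (X i.succ : MvPolynomial (Fin 3) K) ^ m i).IsHomogeneous m.degree := by
      rw [Finsupp.degree_eq_sum]
      exact IsHomogeneous.prod _ _ _ fun i _ => isHomogeneous_X_pow _ _
    have h2 := (isHomogeneous_C (Fin 3) (coeff m P)).mul
      ((isHomogeneous_X_pow (R := K) (0 : Fin 3) (P.totalDegree - m.degree)).mul h1)
    rwa [zero_add, Nat.sub_add_cancel hle] at h2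
  · conv_rhs => rw [P.as_sum]
    rw [map_sum]
    refine Finset.sum_congr rfl fun m _ => ?_
    rw [monomial_eq, Finsupp.prod_fintype _ _ (by simp)]
    simp only [map_mul, map_pow, map_prod, aeval_X, Fin.cons_zero, Fin.cons_succ, one_pow, one_mul,
      MvPolynomial.algHom_C, algebraMap_eq]

theorem aeval_chi_of_isHomogeneous {Q : Fin 3 → ParamField K} {A : Fin 3 → K}
    (h0 : Q 0 - const (A 0) ≠ 0) {H : MvPolynomial (Fin 3) K} {d : ℕ} (hH : H.IsHomogeneous d) :
    aeval (fun i => Q i - const (A i)) H = (Q 0 - const (A 0)) ^ d *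
      aeval (chi Q A) (aeval (Fin.cons 1 X : Fin 3 → MvPolynomial (Fin 2) K) H) := by
  have h1 : aeval (chi Q A) (aeval (Fin.cons 1 X : Fin 3 → MvPolynomial (Fin 2) K) H) =
      aeval (Fin.cons 1 (chi Q A) : Fin 3 → ParamField K) H := by
    rw [← AlgHom.comp_apply]
    congr 1
    ext i
    refine Fin.cases ?_ (fun i => ?_) i <;> simp
  rw [h1, ← aeval_smul_of_isHomogeneous hH]
  congr 2
  ext i
  refine Fin.cases ?_ (fun i => ?_) i
  · simp
  · rw [Fin.cons_succ, chi, mul_div_cancel₀ _ h0]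

/-- The surface is a cone iff the components of the projection from the vertex are algebraically
dependent. -/
theorem isHomogeneous_translate_iff [IsAlgClosed K] {Z : Set (Fin 3 → K)}
    {f : MvPolynomial (Fin 3) K} {Q : Fin 3 → ParamField K} (hf : IsDefiningPolynomial f Z)
    (hQ : IsRationalParametrization Q Z) (hplane : ¬ IsPlane Z) (A : Fin 3 → K) :
    (translate f A).IsHomogeneous f.totalDegree ↔ ¬ AlgebraicIndependent K (chi Q A) := by
  have : Infinite K := IsAlgClosed.instInfinite
  have h0 := param_ne_const hf hQ hplane 0 (A 0)
  have hF0 : translate f A ≠ 0 := by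
    rw [← translateEquiv_apply, Ne, map_eq_zero_iff _ (translateEquiv A).injective]
    exact hf.1.ne_zero
  have htr : ∀ H : MvPolynomial (Fin 3) K,
      aeval (fun i => Q i - const (A i)) H = 0 ↔ translate f A ∣ H := fun H => by
    rw [← translateEquiv_apply, ← (translateEquiv A).apply_symm_apply H,
      map_dvd_iff (translateEquiv A), ← aeval_param_eq_zero_iff hf hQ, translateEquiv_apply,
      aeval_translate]
    simp [const_eq_algebraMap]
  rw [algebraicIndependent_iff]
  push Not
  constructor
  · intro hF
    refine ⟨aeval (Fin.cons 1 X : Fin 3 → MvPolynomial (Fin 2) K) (translate f A), ?_, ?_⟩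
    · have := (htr _).2 dvd_rfl
      rw [aeval_chi_of_isHomogeneous h0 hF] at this
      exact (mul_eq_zero.1 this).resolve_left (pow_ne_zero _ h0)
    · intro hz
      -- If F(1, ·) were zero, F(p) = p₀^d F(1, p₁/p₀, p₂/p₀) would vanish wherever p₀ ≠ 0, so X₀F
      -- would vanish everywhere.
      refine mul_ne_zero (X_ne_zero (0 : Fin 3)) hF0 (MvPolynomial.funext fun p => ?_)
      rw [map_mul, eval_X, map_zero, mul_eq_zero, or_iff_not_imp_left]
      intro hp
      have hp' : p = fun i => p 0 * (Fin.cons 1 (fun j : Fin 2 => p j.succ / p 0) : Fin 3 → K) i := by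
        ext i
        refine Fin.cases ?_ (fun i => ?_) i
        · simp
        · simp [mul_div_cancel₀ _ hp]
      have h2 := aeval_smul_of_isHomogeneous hF (p 0)
        (Fin.cons 1 (fun j : Fin 2 => p j.succ / p 0) : Fin 3 → K)
      rw [← hp', aeval_eq_eval, aeval_eq_eval] at h2
      rw [h2]
      have h3 := congrArg (eval fun j : Fin 2 => p j.succ / p 0) hz
      rw [map_zero, ← aeval_eq_eval, ← AlgHom.comp_apply] at h3
      have h4 : (aeval fun j : Fin 2 => p j.succ / p 0).comp
          (aeval (Fin.cons 1 X : Fin 3 → MvPolynomial (Fin 2) K)) =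
          aeval (R := K) (Fin.cons 1 (fun j : Fin 2 => p j.succ / p 0) : Fin 3 → K) := by
        ext i
        refine Fin.cases ?_ (fun i => ?_) i <;> simp
      rw [h4, aeval_eq_eval] at h3
      rw [h3, mul_zero]
  · rintro ⟨P, hP, hP0⟩
    obtain ⟨d, H, hH, rfl⟩ := exists_homogenization P
    have hH0 : H ≠ 0 := by
      rintro rfl
      exact hP0 (map_zero _)
    have hdvd : translate f A ∣ H := by
      rw [← htr, aeval_chi_of_isHomogeneous h0 hH, hP, mul_zero]
    obtain ⟨k, hk⟩ := isHomogeneous_of_dvd hH hH0 hdvd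
    rwa [← totalDegree_translate f A, hk.totalDegree hF0]

end Cone

/-! ### Nonsingular relations and the numerators of χ(t,s) - χ(h₁,h₂) -/

section GCD

variable {K : Type*} [Field K]

/-- First-order Taylor expansion in the `i`-th variable. -/
theorem exists_taylor {σ S : Type*} [CommRing S] [Algebra K S] (i : σ) (x y : σ → S)
    (hxy : ∀ j, j ≠ i → x j = y j) (P : MvPolynomial σ K) :
    ∃ k, aeval x P - aeval y P = (x i - y i) * (aeval y (pderiv i P) + k * (x i - y i)) := by
  classical
  induction P using MvPolynomial.induction_on with
  | C a => exact ⟨0, by simp [MvPolynomial.algHom_C]⟩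
  | add P P' h h' =>
    obtain ⟨k, h⟩ := h
    obtain ⟨k', h'⟩ := h'
    exact ⟨k + k', by simp only [map_add]; linear_combination h + h'⟩
  | mul_X P j h =>
    obtain ⟨k, h⟩ := h
    by_cases hj : j = i
    · subst hj
      refine ⟨aeval y (pderiv j P) + k * x j, ?_⟩
      simp only [map_mul, aeval_X, pderiv_mul, map_add, pderiv_X_self, map_one]
      linear_combination x j * h
    · refine ⟨k * y j, ?_⟩
      simp only [map_mul, aeval_X, pderiv_mul, map_add, pderiv_X_of_ne hj, map_zero, hxy j hj]
      linear_combination y j * h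

theorem totalDegree_pderiv_le {σ : Type*} (i : σ) (P : MvPolynomial σ K) :
    (pderiv i P).totalDegree ≤ P.totalDegree - 1 := by
  classical
  refine Finset.sup_le fun m hm => ?_
  rw [mem_support_iff, coeff_pderiv] at hm
  have h1 := le_totalDegree (mem_support_iff.2 (left_ne_zero_of_mul hm))
  have h2 : (m + Finsupp.single i 1).sum (fun _ e => e) = m.sum (fun _ e => e) + 1 := by
    rw [Finsupp.sum_add_index' (by simp) (by simp), Finsupp.sum_single_index rfl]
  omega

theorem eq_C_of_pderiv_eq_zero [CharZero K] {σ : Type*} {P : MvPolynomial σ K}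
    (h : ∀ i, pderiv i P = 0) : P = C (coeff 0 P) := by
  classical
  ext m
  rw [coeff_C]
  split_ifs with hm
  · rw [hm]
  · obtain ⟨i, hi⟩ := Finsupp.ne_iff.1 (Ne.symm hm)
    have hle : Finsupp.single i 1 ≤ m := by
      rw [Finsupp.single_le_iff]
      exact Nat.one_le_iff_ne_zero.2 hi
    have h1 := congrArg (coeff (m - Finsupp.single i 1)) (h i)
    rw [coeff_pderiv, tsub_add_cancel_of_le hle, coeff_zero] at h1
    exact (mul_eq_zero.1 h1).resolve_right (Nat.cast_add_one_ne_zero _)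

/-- An algebraic relation can be chosen to be nonsingular at the given point. -/
theorem exists_nonsingular_relation [CharZero K] {σ L : Type*} [Field L] [Algebra K L]
    {x : σ → L} (hx : ¬ AlgebraicIndependent K x) :
    ∃ (P : MvPolynomial σ K) (i : σ), aeval x P = 0 ∧ aeval x (pderiv i P) ≠ 0 := by
  rw [algebraicIndependent_iff] at hx
  push Not at hx
  obtain ⟨P, hP, hP0⟩ := hx
  induction hn : P.totalDegree using Nat.strong_induction_on generalizing P with
  | _ n ih =>
  -- A singular relation is replaced by one of its nonzero derivatives, again a relation, of smaller
  -- degree. In characteristic zero only constants lack such a derivative.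
  by_cases hd : ∀ i, pderiv i P = 0
  · rw [eq_C_of_pderiv_eq_zero hd, MvPolynomial.algHom_C, FaithfulSMul.algebraMap_eq_zero_iff] at hP
    exact absurd (by rw [eq_C_of_pderiv_eq_zero hd, hP, map_zero]) hP0
  · push Not at hd
    obtain ⟨i, hi⟩ := hd
    by_cases h0 : aeval x (pderiv i P) = 0
    · refine ih _ ?_ _ h0 hi rfl
      have h1 := totalDegree_pderiv_le i P
      have h2 : P.totalDegree ≠ 0 := fun h2 => hi (by
        rw [totalDegree_eq_zero_iff_eq_C.1 h2, pderiv_C])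
      omega
    · exact ⟨P, i, hP, h0⟩

/-- The embedding `q(t, s) ↦ q(t, s)` of `K[t, s]` into `K[h₁, h₂][t, s]`. -/
noncomputable def polyTS (K : Type*) [Field K] : ParamRing K →ₐ[K] DoubleRing K :=
  mapAlgHom (Algebra.ofId K (ParamRing K))

/-- The embedding `q(t, s) ↦ q(h₁, h₂)` of `K[t, s]` into `K[h₁, h₂][t, s]`. -/
noncomputable def polyH (K : Type*) [Field K] : ParamRing K →ₐ[K] DoubleRing K :=
  IsScalarTower.toAlgHom K (ParamRing K) (DoubleRing K)

/-- Restriction to the diagonal `(t, s) = (h₁, h₂)`. -/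
noncomputable def diagonal (K : Type*) [Field K] : DoubleRing K →ₐ[K] ParamRing K :=
  (aeval X : DoubleRing K →ₐ[ParamRing K] ParamRing K).restrictScalars K

theorem polyTS_apply (q : ParamRing K) : polyTS K q = map C q := rfl

theorem polyH_apply (q : ParamRing K) : polyH K q = C q := rfl

theorem diagonal_polyTS (q : ParamRing K) : diagonal K (polyTS K q) = q := by
  have : (diagonal K).comp (polyTS K) = AlgHom.id K _ := by
    ext i; simp [diagonal, polyTS_apply]
  exact congrArg (fun φ => φ q) this

theorem diagonal_polyH (q : ParamRing K) : diagonal K (polyH K q) = q := by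
  simp [diagonal, polyH_apply, MvPolynomial.algHom_C]

/-- The numerator, not necessarily reduced, of `χ(t, s) - χ(h₁, h₂)`. -/
noncomputable def crossNum (χ : ParamField K) : DoubleRing K :=
  polyTS K (IsFractionRing.num (ParamRing K) χ) * polyH K (IsFractionRing.den (ParamRing K) χ) -
    polyH K (IsFractionRing.num (ParamRing K) χ) * polyTS K (IsFractionRing.den (ParamRing K) χ)

theorem map_crossNum {S : Type*} [CommRing S] (ψ : DoubleRing K →+* S) (a b : ParamField K →+* S)
    (ha : ∀ q, a (algebraMap _ _ q) = ψ (polyTS K q))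
    (hb : ∀ q, b (algebraMap _ _ q) = ψ (polyH K q)) (χ : ParamField K) :
    ψ (crossNum χ) = (a χ - b χ) * ψ (polyTS K (IsFractionRing.den (ParamRing K) χ) *
      polyH K (IsFractionRing.den (ParamRing K) χ)) := by
  have h : χ * algebraMap _ _ (IsFractionRing.den (ParamRing K) χ : ParamRing K) =
    algebraMap _ _ (IsFractionRing.num (ParamRing K) χ) :=
    IsFractionRing.num_mul_den_eq_num_iff_eq.2 rfl
  have h1 := congrArg a h
  have h2 := congrArg b h
  rw [map_mul, ha, ha] at h1
  rw [map_mul, hb, hb] at h2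
  rw [crossNum, map_sub, map_mul, map_mul, map_mul, ← h1, ← h2]
  ring

theorem map_crossNum_eq_zero_iff {S : Type*} [CommRing S] [Nontrivial S]
    (ψ : DoubleRing K →+* S) (a b : ParamField K →+* S)
    (ha : ∀ q, a (algebraMap _ _ q) = ψ (polyTS K q))
    (hb : ∀ q, b (algebraMap _ _ q) = ψ (polyH K q)) (χ : ParamField K) :
    ψ (crossNum χ) = 0 ↔ a χ = b χ := by
  have hd : algebraMap _ (ParamField K) (IsFractionRing.den (ParamRing K) χ : ParamRing K) ≠ 0 :=
    IsFractionRing.to_map_ne_zero_of_mem_nonZeroDivisors (IsFractionRing.den (ParamRing K) χ).2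
  rw [map_crossNum ψ a b ha hb, map_mul, ← ha, ← hb, ← sub_eq_zero (a := a χ)]
  exact (((isUnit_iff_ne_zero.2 hd).map a).mul ((isUnit_iff_ne_zero.2 hd).map b)).mul_left_eq_zero

theorem inTS_algebraMap (q : ParamRing K) :
    inTS (algebraMap _ _ q) = algebraMap _ (DoubleField K) (polyTS K q) := by
  rw [inTS, IsFractionRing.map, IsLocalization.map_eq]
  rfl

theorem inH_algebraMap (q : ParamRing K) :
    inH (algebraMap _ _ q) = algebraMap _ (DoubleField K) (polyH K q) := by
  rw [inH, IsFractionRing.map, IsLocalization.map_eq]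
  rfl

theorem polyH_injective : Function.Injective (polyH K) :=
  Function.LeftInverse.injective diagonal_polyH

/-- Comparison of the numerator of `χ(t, s) - χ(h₁, h₂)` with its reduced form. -/
theorem exists_crossNum_eq (χ : ParamField K) :
    ∃ e, crossNum χ = IsFractionRing.num (DoubleRing K) (inTS χ - inH χ) * e ∧
      diagonal K e ≠ 0 := by
  set d : ParamRing K := ↑(IsFractionRing.den (ParamRing K) χ)
  have hd : d ≠ 0 := nonZeroDivisors.ne_zero (IsFractionRing.den (ParamRing K) χ).2
  have h := map_crossNum (algebraMap (DoubleRing K) (DoubleField K)) inTS inH inTS_algebraMap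
    inH_algebraMap χ
  have h' : (inTS χ - inH χ) * algebraMap (DoubleRing K) (DoubleField K)
      (IsFractionRing.den (DoubleRing K) (inTS χ - inH χ) : DoubleRing K) = algebraMap _ _
      (IsFractionRing.num (DoubleRing K) (inTS χ - inH χ)) :=
    IsFractionRing.num_mul_den_eq_num_iff_eq.2 rfl
  have hred := IsFractionRing.num_den_reduced (DoubleRing K) (inTS χ - inH χ)
  have hden0 : (IsFractionRing.den (DoubleRing K) (inTS χ - inH χ) : DoubleRing K) ≠ 0 :=
    nonZeroDivisors.ne_zero (IsFractionRing.den (DoubleRing K) (inTS χ - inH χ)).2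
  set nm := IsFractionRing.num (DoubleRing K) (inTS χ - inH χ)
  set dn : DoubleRing K := ↑(IsFractionRing.den (DoubleRing K) (inTS χ - inH χ))
  have hinj := IsFractionRing.injective (DoubleRing K) (DoubleField K)
  have heq : crossNum χ * dn = nm * (polyTS K d * polyH K d) := by
    apply hinj
    rw [map_mul, h, map_mul _ nm, ← h']
    ring
  -- The cancelled factor `e` divides d(t,s)d(h₁,h₂), whose restriction to the diagonal is d² ≠ 0.
  obtain ⟨e, he⟩ : dn ∣ polyTS K d * polyH K d :=
    hred.symm.dvd_of_dvd_mul_left (heq ▸ dvd_mul_left _ _)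
  refine ⟨e, mul_right_cancel₀ hden0 ?_, fun h0 => ?_⟩
  · rw [heq, he]; ring
  · have := congrArg (diagonal K) he
    rw [map_mul, map_mul, diagonal_polyTS, diagonal_polyH, h0, mul_zero] at this
    exact hd (mul_self_eq_zero.1 this)

end GCD

/-! ### Dependence produces a common factor -/

section CommonFactor

variable {K : Type*} [Field K]

/-- Near the diagonal of an integral closed subscheme containing it, a nonsingular relation between
the `x j` propagates the equality `x j (t, s) = x j (h₁, h₂)` to the remaining index. -/
theorem map_crossNum_eq_zero_of_relation {σ : Type*} {x : σ → ParamField K} {P : MvPolynomial σ K}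
    {i : σ} (hP : aeval x P = 0) (hPi : aeval x (pderiv i P) ≠ 0)
    {B : Type*} [CommRing B] [IsDomain B] [Algebra K B]
    (π : DoubleRing K →ₐ[K] B) (δ : B →ₐ[K] ParamRing K) (hδπ : ∀ q, δ (π q) = diagonal K q)
    (h : ∀ j, j ≠ i → π (crossNum (x j)) = 0) : π (crossNum (x i)) = 0 := by
  -- Inverting what is nonzero on the diagonal gives the local ring at its generic point. Both
  -- copies α, β of K(t,s) map into it, and ε restricts back to the diagonal.
  let M : Submonoid B := (nonZeroDivisors (ParamRing K)).comap δ
  have hM : M ≤ nonZeroDivisors B := by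
    intro b hb
    refine mem_nonZeroDivisors_of_ne_zero fun h0 => nonZeroDivisors.ne_zero hb ?_
    rw [h0, map_zero]
  let O := Localization M
  have : IsDomain O := IsLocalization.isDomain_localization hM
  let ψ : DoubleRing K →ₐ[K] O := (IsScalarTower.toAlgHom K B O).comp π
  have hψ : ∀ q, ψ q = 0 ↔ π q = 0 := fun q =>
    map_eq_zero_iff (algebraMap B O) (IsLocalization.injective O hM)
  have hunit : ∀ q, diagonal K q ≠ 0 → IsUnit (ψ q) := fun q hq =>
    IsLocalization.map_units O (⟨π q, mem_nonZeroDivisors_of_ne_zero (by rwa [hδπ])⟩ : M)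
  let α : ParamField K →ₐ[K] O := IsLocalization.liftAlgHom (M := nonZeroDivisors (ParamRing K))
    (f := ψ.comp (polyTS K)) fun y =>
      hunit _ (ne_of_eq_of_ne (diagonal_polyTS _) (nonZeroDivisors.ne_zero y.2))
  let β : ParamField K →ₐ[K] O := IsLocalization.liftAlgHom (M := nonZeroDivisors (ParamRing K))
    (f := ψ.comp (polyH K)) fun y =>
      hunit _ (ne_of_eq_of_ne (diagonal_polyH _) (nonZeroDivisors.ne_zero y.2))
  have hα : ∀ q, α (algebraMap _ _ q) = ψ (polyTS K q) := fun q => IsLocalization.lift_eq _ q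
  have hβ : ∀ q, β (algebraMap _ _ q) = ψ (polyH K q) := fun q => IsLocalization.lift_eq _ q
  let ε : O →+* ParamField K := IsLocalization.lift (M := M)
    (g := (algebraMap (ParamRing K) (ParamField K)).comp δ.toRingHom) fun y =>
      isUnit_iff_ne_zero.2 (IsFractionRing.to_map_ne_zero_of_mem_nonZeroDivisors y.2)
  have hε : ∀ q, ε (ψ q) = algebraMap _ _ (diagonal K q) := fun q =>
    (IsLocalization.lift_eq (M := M) _ (π q)).trans (congrArg (algebraMap _ _) (hδπ q))
  have hεα : ∀ z, ε (α z) = z := fun z => by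
    have : ε.comp α.toRingHom = RingHom.id _ :=
      IsLocalization.ringHom_ext (nonZeroDivisors (ParamRing K)) (RingHom.ext fun q => by
        have := (congrArg ε (hα q)).trans (hε _)
        rwa [diagonal_polyTS] at this)
    exact congrArg (fun φ => φ z) this
  have hεβ : ∀ z, ε (β z) = z := fun z => by
    have : ε.comp β.toRingHom = RingHom.id _ :=
      IsLocalization.ringHom_ext (nonZeroDivisors (ParamRing K)) (RingHom.ext fun q => by
        have := (congrArg ε (hβ q)).trans (hε _)
        rwa [diagonal_polyH] at this)
    exact congrArg (fun φ => φ z) this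
  have hiff : ∀ z, π (crossNum z) = 0 ↔ α z = β z := fun z => by
    rw [← hψ]
    exact map_crossNum_eq_zero_iff ψ.toRingHom α.toRingHom β.toRingHom hα hβ z
  have hcomp : ∀ (γ : ParamField K →ₐ[K] O) (G : MvPolynomial σ K),
      aeval (fun k => γ (x k)) G = γ (aeval x G) := fun γ G =>
    (comp_aeval_apply x γ G).symm
  obtain ⟨k, hk⟩ := exists_taylor i (fun k => α (x k)) (fun k => β (x k))
    (fun j hj => (hiff _).1 (h j hj)) P
  rw [hcomp, hcomp, hcomp, hP, map_zero, map_zero, sub_zero, eq_comm, mul_eq_zero] at hk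
  rw [hiff, ← sub_eq_zero]
  -- The second Taylor factor restricts to ∂ᵢP(x) ≠ 0 on the diagonal, so in this domain the first
  -- must vanish.
  refine hk.resolve_right fun h0 => hPi ?_
  have := congrArg ε h0
  rwa [map_add, map_mul, map_sub, hεα, hεβ, hεβ, sub_self, mul_zero, add_zero, map_zero] at this

theorem dvd_crossNum_of_relation {σ : Type*} {x : σ → ParamField K} {P : MvPolynomial σ K} {i : σ}
    (hP : aeval x P = 0) (hPi : aeval x (pderiv i P) ≠ 0) {p : DoubleRing K} (hp : Prime p)
    (hpd : diagonal K p = 0) (h : ∀ j, j ≠ i → p ∣ crossNum (x j)) : p ∣ crossNum (x i) := by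
  have hprime : (Ideal.span {p}).IsPrime := (Ideal.span_singleton_prime hp.ne_zero).2 hp
  have hπ : ∀ q, Ideal.Quotient.mkₐ K (Ideal.span {p}) q = 0 ↔ p ∣ q := fun q => by
    rw [← Ideal.mem_span_singleton]
    exact Ideal.Quotient.eq_zero_iff_mem
  have hker : ∀ a ∈ Ideal.span {p}, diagonal K a = 0 := by
    intro a ha
    obtain ⟨c, rfl⟩ := Ideal.mem_span_singleton.1 ha
    rw [map_mul, hpd, zero_mul]
  have := map_crossNum_eq_zero_of_relation hP hPi (B := DoubleRing K ⧸ Ideal.span {p})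
    (Ideal.Quotient.mkₐ K (Ideal.span {p}))
    (Ideal.Quotient.liftₐ (Ideal.span {p}) (diagonal K) hker) (fun q => rfl)
    fun j hj => (hπ _).2 (h j hj)
  exact (hπ _).1 this

theorem exists_common_factor [CharZero K] {x : Fin 2 → ParamField K}
    (hx : ¬ AlgebraicIndependent K x) (hx0 : ∀ i, crossNum (x i) ≠ 0) :
    ∃ p : DoubleRing K, Irreducible p ∧ 0 < p.totalDegree ∧
      ∀ i, p ∣ IsFractionRing.num (DoubleRing K) (inTS (x i) - inH (x i)) := by
  obtain ⟨P, i, hP, hPi⟩ := exists_nonsingular_relation hx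
  -- Passing to the reduced numerator loses no prime vanishing on the diagonal, because the
  -- cancelled factor does not vanish there.
  have hfactor : ∀ {p : DoubleRing K}, Prime p → diagonal K p = 0 → ∀ j, p ∣ crossNum (x j) →
      p ∣ IsFractionRing.num (DoubleRing K) (inTS (x j) - inH (x j)) := fun {p} hp hpd j hj => by
    obtain ⟨e, he, he0⟩ := exists_crossNum_eq (x j)
    rw [he] at hj
    refine (hp.dvd_or_dvd hj).resolve_right ?_
    rintro ⟨c, rfl⟩
    rw [map_mul, hpd, zero_mul] at he0
    exact he0 rfl
  have hj : ∀ j, j ≠ i → j = i.rev := by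
    clear hPi; revert i; decide
  obtain ⟨fs, hfs, hprod⟩ := UniqueFactorizationMonoid.exists_prime_factors _ (hx0 i.rev)
  -- χ(t,s) - χ(h₁,h₂) vanishes on the diagonal, hence so does one of the prime factors.
  have hdiag : diagonal K fs.prod = 0 := by
    obtain ⟨u, hu⟩ := hprod.symm
    rw [← hu, map_mul, crossNum, map_sub, map_mul, map_mul]
    simp only [diagonal_polyTS, diagonal_polyH]
    ring
  rw [map_multiset_prod, Multiset.prod_eq_zero_iff, Multiset.mem_map] at hdiag
  obtain ⟨p, hpf, hpd⟩ := hdiag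
  have hp := hfs p hpf
  have hpj : p ∣ crossNum (x i.rev) := (Multiset.dvd_prod hpf).trans hprod.dvd
  have hpi : p ∣ crossNum (x i) :=
    dvd_crossNum_of_relation hP hPi hp hpd fun j hji => hj j hji ▸ hpj
  refine ⟨p, hp.irreducible, ?_, fun j => hfactor hp hpd j ?_⟩
  -- A polynomial in h₁, h₂ alone equals its restriction to the diagonal, so it cannot vanish there
  -- unless it is zero.
  · rw [Nat.pos_iff_ne_zero]
    intro h0
    rw [totalDegree_eq_zero_iff_eq_C] at h0
    rw [h0, ← polyH_apply, diagonal_polyH] at hpd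
    exact hp.ne_zero (by rw [h0, hpd, map_zero])
  · by_cases hji : j = i
    · exact hji ▸ hpi
    · exact hj j hji ▸ hpj

end CommonFactor

/-! ### A common factor forces dependence -/

section Converse

variable {K : Type*} [Field K]

theorem commAlgEquiv_polyTS (q : ParamRing K) :
    commAlgEquiv K (Fin 2) (Fin 2) (polyTS K q) = polyH K q := by
  have : (commAlgEquiv K (Fin 2) (Fin 2)).toAlgHom.comp (polyTS K) = polyH K := by
    ext i; simp [polyTS_apply, polyH_apply]
  exact congrArg (fun φ => φ q) this

theorem commAlgEquiv_polyH (q : ParamRing K) :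
    commAlgEquiv K (Fin 2) (Fin 2) (polyH K q) = polyTS K q :=
  commAlgEquiv_C q

theorem totalDegree_eq_zero_of_dvd_polyH {p : DoubleRing K} {q : ParamRing K} (hq : q ≠ 0)
    (h : p ∣ polyH K q) : p.totalDegree = 0 := by
  have := totalDegree_le_of_dvd_of_isDomain h (by
    rwa [Ne, map_eq_zero_iff _ polyH_injective])
  rwa [polyH_apply, totalDegree_C, Nat.le_zero] at this

/-- Swapping the two pairs of variables makes q a nonzero constant, whose divisors are constant. -/
theorem exists_eq_polyTS_of_dvd {p : DoubleRing K} {q : ParamRing K} (hq : q ≠ 0)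
    (h : p ∣ polyTS K q) : ∃ r, p = polyTS K r := by
  have h1 := map_dvd (commAlgEquiv K (Fin 2) (Fin 2)) h
  rw [commAlgEquiv_polyTS] at h1
  have h2 := totalDegree_eq_zero_of_dvd_polyH hq h1
  rw [totalDegree_eq_zero_iff_eq_C] at h2
  exact ⟨_, (commAlgEquiv K (Fin 2) (Fin 2)).injective (by
    rw [commAlgEquiv_polyTS]; exact h2)⟩

/-- `χ(t, s) - χ(h₁, h₂)` has no nontrivial factor in `K[t, s]`, unless `χ` is constant. -/
theorem isUnit_of_polyTS_dvd_crossNum {χ : ParamField K}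
    (hχ : ∀ e : K, χ ≠ algebraMap K (ParamField K) e) {r : ParamRing K}
    (h : polyTS K r ∣ crossNum χ) : IsUnit r := by
  have hval := IsFractionRing.mk'_num_den' (ParamRing K) χ
  have hred := IsFractionRing.num_den_reduced (ParamRing K) χ
  have hd : (IsFractionRing.den (ParamRing K) χ : ParamRing K) ≠ 0 :=
    nonZeroDivisors.ne_zero (IsFractionRing.den (ParamRing K) χ).2
  -- After the swap r is a constant polynomial, so it divides every coefficient n·d_m - n_m·d.
  have h1 := map_dvd (commAlgEquiv K (Fin 2) (Fin 2)) h
  rw [crossNum, map_sub, map_mul, map_mul, commAlgEquiv_polyTS, commAlgEquiv_polyTS,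
    commAlgEquiv_polyTS, commAlgEquiv_polyH, commAlgEquiv_polyH] at h1
  generalize (IsFractionRing.den (ParamRing K) χ : ParamRing K) = d at *
  generalize IsFractionRing.num (ParamRing K) χ = n at *
  simp only [polyH_apply, polyTS_apply] at h1
  rw [C_dvd_iff_dvd_coeff] at h1
  have h2 : ∀ m, r ∣ n * C (coeff m d) - C (coeff m n) * d := fun m => by
    have := h1 m
    rwa [coeff_sub, coeff_C_mul, coeff_map, mul_comm (map C n), coeff_C_mul, coeff_map,
      mul_comm d] at this
  obtain ⟨m, hm⟩ := ne_zero_iff.1 hd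
  -- If all these 2×2 minors vanished, n and d would be proportional and χ constant. A nonzero minor
  -- lets n be eliminated, giving r ∣ d and then r ∣ n.
  obtain ⟨m', hm'⟩ : ∃ m', coeff m d * coeff m' n - coeff m' d * coeff m n ≠ 0 := by
    by_contra! hall
    refine hχ (coeff m n / coeff m d) ?_
    have h3 : C (coeff m d) * n = C (coeff m n) * d := by
      ext m'
      rw [coeff_C_mul, coeff_C_mul]
      linear_combination hall m'
    have h4 := congrArg (algebraMap (ParamRing K) (ParamField K)) h3
    have hC : ∀ a : K, algebraMap (ParamRing K) (ParamField K) (C a) = algebraMap K _ a :=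
      fun a => const_eq_algebraMap a
    have h5 : algebraMap (ParamRing K) (ParamField K) d ≠ 0 := by
      rwa [Ne, map_eq_zero_iff _ (IsFractionRing.injective _ _)]
    have h6 : algebraMap K (ParamField K) (coeff m d) ≠ 0 := by
      rwa [Ne, map_eq_zero_iff _ (algebraMap K (ParamField K)).injective]
    rw [map_mul, map_mul, hC, hC] at h4
    rw [← hval, map_div₀, div_eq_div_iff h5 h6]
    linear_combination h4
  have hCunit : ∀ a : K, a ≠ 0 → IsUnit (C a : ParamRing K) := fun a ha =>
    (isUnit_iff_ne_zero.2 ha).map C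
  have hrd : r ∣ d := by
    rw [← (hCunit _ hm').dvd_mul_left]
    have := dvd_sub ((h2 m).mul_left (C (coeff m' d))) ((h2 m').mul_left (C (coeff m d)))
    convert this using 1
    rw [map_sub, map_mul, map_mul]
    ring
  have hrn : r ∣ n := by
    rw [← (hCunit _ hm).dvd_mul_right]
    exact (dvd_sub_left (hrd.mul_left _)).1 (h2 m)
  exact hred hrn hrd

theorem crossNum_ne_zero {χ : ParamField K} (hχ : ∀ e : K, χ ≠ algebraMap K (ParamField K) e) :
    crossNum χ ≠ 0 := by
  intro h
  have := isUnit_of_polyTS_dvd_crossNum hχ (r := 0) (by rw [h]; exact dvd_zero _)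
  exact not_isUnit_zero this

theorem trdeg_paramField : Algebra.trdeg K (ParamField K) = 2 := by
  have h := trdeg_add_eq K (ParamRing K) (A := ParamField K)
  have : Algebra.IsAlgebraic (ParamRing K) (ParamField K) :=
    IsFractionRing.comap_isAlgebraic_iff (K := ParamField K) |>.2 inferInstance
  rw [trdeg_eq_zero (R := ParamRing K), add_zero, MvPolynomial.trdeg_of_isDomain] at h
  rw [← h]
  simp

theorem degreeOf_le_of_dvd {σ R : Type*} [CommRing R] [IsDomain R] {p q : MvPolynomial σ R}
    (hq : q ≠ 0) (h : p ∣ q) (i : σ) : degreeOf i p ≤ degreeOf i q := by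
  obtain ⟨c, rfl⟩ := h
  obtain ⟨hp, hc⟩ := mul_ne_zero_iff.1 hq
  rw [degreeOf_mul_eq hp hc]
  exact Nat.le_add_right _ _

theorem degreeOf_aeval_X {σ R : Type*} [CommRing R] {i j : σ} (hij : j ≠ i)
    (b : Polynomial R) : degreeOf j (Polynomial.aeval (X i : MvPolynomial σ R) b) = 0 := by
  rw [← Nat.le_zero, degreeOf_le_iff]
  have h : Polynomial.aeval (X i : MvPolynomial σ R) b ∈ supported R {i} := by
    rw [supported, Set.image_singleton]
    exact Polynomial.aeval_mem_adjoin_singleton R _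
  rw [mem_supported] at h
  intro m hm
  rw [Nat.le_zero]
  by_contra h0
  exact hij (h (mem_vars_iff_mem_support j |>.2 ⟨m, hm, Finsupp.mem_support_iff.2 h0⟩))

theorem totalDegree_eq_zero_of_degreeOf {σ R : Type*} [CommRing R] {p : MvPolynomial σ R}
    (h : ∀ i, degreeOf i p = 0) : p.totalDegree = 0 := by
  rw [totalDegree_eq_zero_iff]
  intro m hm i
  exact Nat.le_zero.1 (h i ▸ monomial_le_degreeOf i hm)

theorem not_algebraicIndependent_of_common_factor {x : Fin 2 → ParamField K}
    (hx : ∀ (i : Fin 2) (e : K), x i ≠ algebraMap K (ParamField K) e) {p : DoubleRing K}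
    (hp : Prime p) (hpd : 0 < p.totalDegree) (h : ∀ i, p ∣ crossNum (x i)) :
    ¬ AlgebraicIndependent K x := by
  intro hind
  have hprime : (Ideal.span {p}).IsPrime := (Ideal.span_singleton_prime hp.ne_zero).2 hp
  let B := DoubleRing K ⧸ Ideal.span {p}
  let E := FractionRing B
  let ψ : DoubleRing K →ₐ[K] E :=
    (IsScalarTower.toAlgHom K B E).comp (Ideal.Quotient.mkₐ K (Ideal.span {p}))
  have hψ : ∀ q, ψ q = 0 ↔ p ∣ q := fun q => by
    rw [← Ideal.mem_span_singleton, ← Ideal.Quotient.eq_zero_iff_mem]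
    exact map_eq_zero_iff (algebraMap B E) (IsFractionRing.injective B E)
  -- Since p lies in neither K[t,s] nor K[h₁,h₂], both copies of K(t,s) embed in the function field
  -- of p = 0.
  have hTS : ∀ q, q ≠ 0 → ψ (polyTS K q) ≠ 0 := fun q hq h0 => by
    obtain ⟨r, rfl⟩ := exists_eq_polyTS_of_dvd hq ((hψ _).1 h0)
    exact hp.not_isUnit ((isUnit_of_polyTS_dvd_crossNum (hx 0) (h 0)).map (polyTS K))
  have hH : ∀ q, q ≠ 0 → ψ (polyH K q) ≠ 0 := fun q hq h0 =>
    hpd.ne' (totalDegree_eq_zero_of_dvd_polyH hq ((hψ _).1 h0))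
  let α : ParamField K →ₐ[K] E := IsLocalization.liftAlgHom (M := nonZeroDivisors (ParamRing K))
    (f := ψ.comp (polyTS K)) fun y => isUnit_iff_ne_zero.2 (hTS _ (nonZeroDivisors.ne_zero y.2))
  let β : ParamField K →ₐ[K] E := IsLocalization.liftAlgHom (M := nonZeroDivisors (ParamRing K))
    (f := ψ.comp (polyH K)) fun y => isUnit_iff_ne_zero.2 (hH _ (nonZeroDivisors.ne_zero y.2))
  have hα : ∀ q, α (algebraMap _ _ q) = ψ (polyTS K q) := fun q => IsLocalization.lift_eq _ q
  have hβ : ∀ q, β (algebraMap _ _ q) = ψ (polyH K q) := fun q => IsLocalization.lift_eq _ q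
  have hαβ : ∀ i, α (x i) = β (x i) := fun i =>
    (map_crossNum_eq_zero_iff ψ.toRingHom α.toRingHom β.toRingHom hα hβ _).1 ((hψ _).2 (h i))
  have hle : Algebra.adjoin K (Set.range x) ≤ AlgHom.equalizer α β := by
    rw [Algebra.adjoin_le_iff]
    rintro _ ⟨i, rfl⟩
    exact hαβ i
  have hbasis : IsTranscendenceBasis K x :=
    hind.isTranscendenceBasis_of_lift_trdeg_le_of_finite (by simp [trdeg_paramField])
  have halg := hbasis.isAlgebraic
  -- An equation of X l over K[x₀,x₁] is carried over by α. As α and β agree on its coefficients,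
  -- these lie in K(h₁,h₂), and clearing denominators gives `b`.
  have hfactor : ∀ l : Fin 2, ∃ b : Polynomial (ParamRing K), b ≠ 0 ∧
      p ∣ Polynomial.aeval (X l : DoubleRing K) b := fun l => by
    obtain ⟨a, ha0, ha⟩ := halg.isAlgebraic (algebraMap (ParamRing K) (ParamField K) (X l))
    let ι := algebraMap (Algebra.adjoin K (Set.range x)) (ParamField K)
    refine ⟨IsLocalization.integerNormalization (nonZeroDivisors (ParamRing K)) (a.map ι), ?_, ?_⟩
    · rw [Ne, IsFractionRing.integerNormalization_eq_zero_iff,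
        Polynomial.map_eq_zero_iff (FaithfulSMul.algebraMap_injective _ _)]
      exact ha0
    · rw [← hψ]
      have hc : β.toRingHom.comp ι = α.toRingHom.comp ι := RingHom.ext fun y => (hle y.2).symm
      have h1 := IsLocalization.integerNormalization_eval₂_eq_zero
        (nonZeroDivisors (ParamRing K)) β.toRingHom (a.map ι)
        (x := α (algebraMap (ParamRing K) (ParamField K) (X l))) (by
          rw [Polynomial.eval₂_map, hc]
          have := congrArg α ha
          rw [map_zero, Polynomial.aeval_def] at this
          rw [← this]
          exact (Polynomial.hom_eval₂ _ _ α.toRingHom _).symm)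
      have h2 : β.toRingHom.comp (algebraMap (ParamRing K) (ParamField K)) =
          ψ.toRingHom.comp (algebraMap (ParamRing K) (DoubleRing K)) := RingHom.ext hβ
      have h3 : polyTS K (X l) = X l := by rw [polyTS_apply, map_X]
      rw [h2, hα, h3] at h1
      rw [← h1, Polynomial.aeval_def]
      exact Polynomial.hom_eval₂ _ _ ψ.toRingHom _
  refine hpd.ne' (totalDegree_eq_zero_of_degreeOf fun j => ?_)
  -- The multiple of p in the other variable is free of X j, so p is too.
  obtain ⟨b, hb0, hb⟩ := hfactor j.rev
  have hb0' : Polynomial.aeval (X j.rev : DoubleRing K) b ≠ 0 := fun h0 =>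
    hb0 ((transcendental_iff.1 (transcendental_X (ParamRing K) j.rev)) b h0)
  have hle := degreeOf_le_of_dvd hb0' hb j
  rwa [degreeOf_aeval_X (by clear * -; revert j; decide), Nat.le_zero] at hle

theorem exists_irreducible_factor_totalDegree_pos {σ R : Type*} [CommRing R] [IsDomain R]
    [UniqueFactorizationMonoid (MvPolynomial σ R)] {g : MvPolynomial σ R}
    (hg : 0 < g.totalDegree) : ∃ p, Prime p ∧ 0 < p.totalDegree ∧ p ∣ g := by
  by_contra! hall
  have hg0 : g ≠ 0 := by rintro rfl; simp at hg
  obtain ⟨fs, hfs, u, hu⟩ := UniqueFactorizationMonoid.exists_prime_factors g hg0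
  have hfs0 : fs.prod ≠ 0 := fun h0 => hg0 (by rw [← hu, h0, zero_mul])
  have h1 : fs.prod.totalDegree = 0 := by
    refine Nat.le_zero.1 ((totalDegree_multiset_prod _).trans (Nat.le_zero.2 ?_))
    rw [Multiset.sum_eq_zero_iff]
    intro n hn
    obtain ⟨q, hq, rfl⟩ := Multiset.mem_map.1 hn
    by_contra h0
    refine hall q (hfs q hq) (Nat.pos_of_ne_zero h0) ?_
    exact (Multiset.dvd_prod hq).trans (hu ▸ dvd_mul_right _ _)
  have h2 := totalDegree_le_of_dvd_of_isDomain (f := (u : MvPolynomial σ R)) (g := 1)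
    (u.isUnit.dvd) one_ne_zero
  rw [totalDegree_one] at h2
  rw [← hu, totalDegree_mul_of_isDomain hfs0 u.ne_zero] at hg
  omega

theorem gPoly_ne_one_iff_totalDegree_pos (Q : Fin 3 → ParamField K) (A : Fin 3 → K) :
    gPoly Q A ≠ 1 ↔ 0 < (gGcd Q A).totalDegree := by
  rw [gPoly]
  split_ifs with h
  · refine iff_of_true (fun h1 => ?_) h
    rw [h1, totalDegree_one] at h
    exact lt_irrefl _ h
  · simp [h]

theorem gPoly_ne_one_iff [CharZero K] {Q : Fin 3 → ParamField K} {A : Fin 3 → K}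
    (hχ : ∀ (i : Fin 2) (e : K), chi Q A i ≠ algebraMap K (ParamField K) e) :
    gPoly Q A ≠ 1 ↔ ¬ AlgebraicIndependent K (chi Q A) := by
  let _ := UniqueFactorizationMonoid.toGCDMonoid (DoubleRing K)
  have hdvd : ∀ p : DoubleRing K, p ∣ gGcd Q A ↔ ∀ i, p ∣ gPolyComponent Q A i := fun p => by
    rw [Fin.forall_fin_two]
    exact dvd_gcd_iff _ _ _
  rw [gPoly_ne_one_iff_totalDegree_pos]
  constructor
  · intro h
    obtain ⟨p, hp, hpd, hpg⟩ := exists_irreducible_factor_totalDegree_pos h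
    refine not_algebraicIndependent_of_common_factor hχ hp hpd fun i => ?_
    obtain ⟨e, he, -⟩ := exists_crossNum_eq (chi Q A i)
    rw [he]
    exact ((hdvd p).1 hpg i).mul_right _
  · intro h
    obtain ⟨p, -, hpd, hpg⟩ := exists_common_factor h fun i => crossNum_ne_zero (hχ i)
    -- The degree comparison needs a nonzero gcd: otherwise g₁ = 0 and χ₁ would be constant.
    refine hpd.trans_le (totalDegree_le_of_dvd_of_isDomain ((hdvd p).2 hpg) fun h0 => ?_)
    obtain ⟨e, he, -⟩ := exists_crossNum_eq (chi Q A 0)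
    have h1 := (hdvd 0).1 (h0 ▸ dvd_rfl) 0
    refine crossNum_ne_zero (hχ 0) ?_
    rw [he, ← zero_dvd_iff]
    exact h1.mul_right _

end Converse

end RationalSurface

theorem mainTheorem4 {K : Type*} [Field K] [IsAlgClosed K] [CharZero K]
    (Z : Set (Fin 3 → K)) (f : MvPolynomial (Fin 3) K)
    (hf : RationalSurface.IsDefiningPolynomial f Z)
    (Q : Fin 3 → RationalSurface.ParamField K)
    (hQ : RationalSurface.IsRationalParametrization Q Z)
    (hplane : ¬ RationalSurface.IsPlane Z)
    (A : Fin 3 → K) :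
    (RationalSurface.IsConeWithVertex Z A ↔ RationalSurface.gPoly Q A ≠ 1) ∧
    (RationalSurface.gPoly Q A ≠ 1 ↔
      RationalSurface.multiplicityAt f A = f.totalDegree) := by
  have hg := RationalSurface.gPoly_ne_one_iff
    (RationalSurface.chi_ne_const hf hQ hplane A)
  rw [hg, RationalSurface.isConeWithVertex_iff hf,
    RationalSurface.multiplicityAt_eq_iff hf.1.ne_zero,
    RationalSurface.isHomogeneous_translate_iff hf hQ hplane]
  exact ⟨Iff.rfl, Iff.rfl⟩
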